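/- **Definitions.** A *pDAG* is a finite directed acyclic graph whose nodes are partitioned into visible and latent nodes; $\mathrm{pa}(v)$ is the set of parents of $v$, and $\mathrm{pa}(S)=\bigcup_{v\in S}\mathrm{pa}(v)$. For a pDAG $\mathcal G$ and cardinalities $\vec c$ of the visible variables, let $\mathcal M(\mathcal G,\vec c)$ be the set of probability distributions on the visible variables of the form $$P(X_{\mathrm{vis}})=\sum_{X_{\mathrm{lat}}}\sum_{E}\prod_{a}\delta_{X_a,\,f_a(X_{\mathrm{pa}(a)},E_a)}\,P(E_a),$$ where $a$ runs over all nodes, for some finite cardinalities of the latent variables and of the error variables $E_a$, some distributions $P(E_a)$ and some functions $f_a$. $\mathcal G$ *observationally dominates* $\mathcal G'$ (with the same visible nodes), $\mathcal G\succeq\mathcal G'$, if $\mathcal M(\mathcal G',\vec c)\subseteq\mathcal M(\mathcal G,\vec c)$ for all $\vec c$; they are *observationally equivalent*, $\mathcal G\cong\mathcal G'$, if $\mathcal M(\mathcal G',\vec c)=\mathcal M(\mathcal G,\vec c)$ for all $\vec c$. An *mDAG* $\mathfrak G=(\mathcal D,\mathcal B)$ is a DAG $\mathcal D$ on a finite set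 $V$ together with a simplicial complex $\mathcal B$ on $V$ (a family of nonempty subsets of $V$, the *faces*, that contains all singletons and all nonempty subsets of its members); the inclusion-maximal faces are the *facets*. Its canonical pDAG has the visible nodes $V$ with the edges of $\mathcal D$, and for each facet $A$ one latent node with an edge to every element of $A$ and no other edges. Dominance and equivalence of mDAGs mean those of their canonical pDAGs. $\mathfrak G'$ *structurally dominates* $\mathfrak G$ if it has all the directed edges and all the faces of $\mathfrak G$. **Moderate Facet-Merging.** Let $\mathfrak G=(\mathcal D,\mathcal B)$ be an mDAG, $C$ a facet and $D$ a face of $\mathcal B$ (for instance a facet), with $C\cap D=\emptyset$. Let $\mathfrak G'$ be the mDAG obtained from $\mathfrak G$ by adding $C\cup D$ and all nonempty subsets of it to $\mathcal B$. Suppose that 1. $\mathrm{pa}_{\mathcal D}(C)\cup C\subseteq \mathrm{pa}_{\mathcal D}(d)$ for each $d\in D$; 2. every facet $B'$ of $\mathcal B$ that contains some $c\in C$ and is not contained in $C$ satisfies $D\subseteq B'$. Then $\mathfrak G\succeq\mathfrak G'$. Moreover $\mathfrak G'$ structurally dominates $\mathfrak G$, so $\mathfrak G'\succeq\mathfrak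 G$, and therefore $\mathfrak G\cong\mathfrak G'$. **Relaxation.** These hypotheses are implied by those of Weak Facet-Merging (and Evans' rule), namely: $C$ and $D$ are disjoint facets, condition 1 holds, and for every $c\in C$ the facet $C$ is the only facet that contains $c$. The relaxation is strict: there are an mDAG $\mathfrak G_0$ on three nodes and sets $C_0,D_0$ that satisfy the hypotheses of Moderate Facet-Merging, such that the mDAG $\mathfrak G_0'$ obtained by adding $C_0\cup D_0$ differs from $\mathfrak G_0$, while no pair $C_1,D_1$ that satisfies the hypotheses of Weak Facet-Merging in $\mathfrak G_0$ has $\mathfrak G_0'$ as the result of adding $C_1\cup D_1$. -/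

import Mathlib

open Finset

noncomputable section

namespace CausalStructure

/-- A directed acyclic graph with set of nodes `N`. -/
@[ext]
structure DAG (N : Type*) where
  /-- `edge a b` is the directed edge `a → b`. -/
  edge : N → N → Prop
  /-- There is no directed cycle. -/
  acyclic : ∀ a, ¬ Relation.TransGen edge a a

/-- The set of parents of a node. -/
def DAG.pa {N : Type*} (G : DAG N) (v : N) : Set N := {u | G.edge u v}

/-- The set of parents of a set of nodes: the union of the sets of parents of its elements. -/
def DAG.paSet {N : Type*} (G : DAG N) (S : Set N) : Set N := ⋃ v ∈ S, G.pa v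

/-- A partitioned DAG: a DAG whose nodes are partitioned into the visible nodes `V` and the
latent nodes `L`. -/
abbrev PDAG (V L : Type*) := DAG (V ⊕ L)

/-- The parameters of a causal model on the DAG `G`, when the state space of each node `a` is
`Fin (card a)`: for every node an error variable (with a finite state space), its distribution,
and the function that determines the variable from its parents and its error variable. -/
structure Parameters {N : Type*} (G : DAG N) (card : N → ℕ) where
  /-- the cardinality of the error variable -/
  errCard : N → ℕ
  /-- the distribution of the error variable -/
  errProb : ∀ a, Fin (errCard a) → ℝ
  errProb_mem : ∀ a, errProb a ∈ stdSimplex ℝ (Fin (errCard a))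
  /-- the functional dependence `X_a = f_a (X_{pa a}, E_a)` -/
  f : ∀ a, (∀ b : G.pa a, Fin (card b)) → Fin (errCard a) → Fin (card a)

/-- A joint value of all variables, put together from a joint value of the visible variables and
a joint value of the latent variables. -/
def combine {V L : Type*} {cV : V → ℕ} {cL : L → ℕ} (x : ∀ v, Fin (cV v))
    (y : ∀ l, Fin (cL l)) : ∀ a : V ⊕ L, Fin (Sum.elim cV cL a)
  | Sum.inl v => x v
  | Sum.inr l => y l

open Classical in
/-- The distribution over the visible variables that a choice of parameters yields:
`P(x) = ∑_{latents} ∑_{errors} ∏_a δ(X_a, f_a (X_{pa a}, E_a)) P(E_a)`. -/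
def Parameters.visible {V L : Type*} [Fintype V] [Fintype L] {G : PDAG V L} {cV : V → ℕ}
    {cL : L → ℕ} (θ : Parameters G (Sum.elim cV cL)) (x : ∀ v, Fin (cV v)) : ℝ :=
  ∑ y : ∀ l, Fin (cL l), ∑ e : ∀ a, Fin (θ.errCard a), ∏ a : V ⊕ L,
    (if combine x y a = θ.f a (fun b => combine x y b) (e a) then 1 else 0) * θ.errProb a (e a)

open Classical in
/-- The set of probability distributions over the visible variables, with cardinalities `cV`,
that are realizable by the pDAG `G` under arbitrary finite cardinalities of the latent variables
(and of the error variables). -/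
def realizable {V L : Type*} [Fintype V] [Fintype L] (G : PDAG V L) (cV : V → ℕ) :
    Set ((∀ v, Fin (cV v)) → ℝ) :=
  {P | P ∈ stdSimplex ℝ (∀ v, Fin (cV v)) ∧
    ∃ (cL : L → ℕ) (θ : Parameters G (Sum.elim cV cL)), ∀ x, P x = θ.visible x}

/-- `G` observationally dominates `G'`: for all cardinalities of the visible variables, every
distribution that is realizable by `G'` is realizable by `G`. -/
def PDAG.ObsDominates {V L L' : Type*} [Fintype V] [Fintype L] [Fintype L'] (G : PDAG V L)
    (G' : PDAG V L') : Prop :=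
  ∀ cV : V → ℕ, realizable G' cV ⊆ realizable G cV

/-- `G` and `G'` are observationally equivalent. -/
def PDAG.ObsEquiv {V L L' : Type*} [Fintype V] [Fintype L] [Fintype L'] (G : PDAG V L)
    (G' : PDAG V L') : Prop :=
  ∀ cV : V → ℕ, realizable G' cV = realizable G cV

/-- A marginalized DAG: a DAG (the directed structure) together with a simplicial complex over
its nodes. In Mathlib, the faces of a simplicial complex are nonempty. -/
@[ext]
structure MDAG (V : Type*) where
  /-- the directed structure -/
  dag : DAG V
  /-- the simplicial complex -/
  complex : AbstractSimplicialComplex V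

namespace MDAG

variable {V : Type*}

/-- A facet is an inclusion-maximal face. -/
def IsFacet (G : MDAG V) (A : Finset V) : Prop := Maximal (fun B => B ∈ G.complex) A

/-- The latent nodes of the canonical pDAG: one for each facet. -/
abbrev Latent (G : MDAG V) := {A : Finset V // G.IsFacet A}

open Classical in
instance [Fintype V] (G : MDAG V) : Fintype G.Latent := Fintype.ofFinite _

/-- The directed edges of the canonical pDAG: those of the directed structure, and an edge from
the latent node of each facet to every element of that facet. -/
inductive CanEdge (G : MDAG V) : V ⊕ G.Latent → V ⊕ G.Latent → Prop
  | directed {u v : V} (h : G.dag.edge u v) : CanEdge G (Sum.inl u) (Sum.inl v)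
  | latent {A : G.Latent} {v : V} (h : v ∈ A.1) : CanEdge G (Sum.inr A) (Sum.inl v)

theorem CanEdge.transGen_inl {G : MDAG V} {a b : V ⊕ G.Latent}
    (h : Relation.TransGen G.CanEdge a b) :
    ∃ v, b = Sum.inl v ∧ ∀ u, a = Sum.inl u → Relation.TransGen G.dag.edge u v := by
  induction h with
  | single h =>
    cases h with
    | @directed u v h =>
      refine ⟨v, rfl, fun u' hu => ?_⟩
      cases hu
      exact .single h
    | @latent A v h =>
      exact ⟨v, rfl, fun u' hu => by cases hu⟩
  | tail _ h ih =>
    obtain ⟨w, rfl, hw⟩ := ih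
    cases h with
    | @directed u v h => exact ⟨v, rfl, fun u' hu => (hw u' hu).tail h⟩

/-- The canonical pDAG of an mDAG. -/
def can (G : MDAG V) : PDAG V G.Latent where
  edge := G.CanEdge
  acyclic a h := by
    obtain ⟨v, rfl, hv⟩ := CanEdge.transGen_inl h
    exact G.dag.acyclic v (hv v rfl)

/-- Observational dominance `G ⪰ G'` of mDAGs, through their canonical pDAGs. -/
def ObsDominates [Fintype V] (G G' : MDAG V) : Prop := PDAG.ObsDominates G.can G'.can

/-- Observational equivalence `G ≅ G'` of mDAGs, through their canonical pDAGs. -/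
def ObsEquiv [Fintype V] (G G' : MDAG V) : Prop := PDAG.ObsEquiv G.can G'.can

/-- `G` structurally dominates `G'`: the directed edges of `G'` are directed edges of `G` and the
faces of `G'` are faces of `G`. -/
def StructDominates (G G' : MDAG V) : Prop :=
  (∀ u v, G'.dag.edge u v → G.dag.edge u v) ∧ G'.complex ≤ G.complex

/-- The mDAG obtained from `G` by adding `B` and all of the (nonempty) sets contained in `B` to
the simplicial complex. -/
def addFace (G : MDAG V) (B : Finset V) : MDAG V where
  dag := G.dag
  complex :=
    { faces := {A | A ∈ G.complex ∨ (A.Nonempty ∧ A ⊆ B)}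
      isRelLowerSet_faces := by
        rintro A (hA | ⟨hA, hAB⟩)
        · have h := G.complex.isRelLowerSet_faces hA
          exact ⟨h.1, fun S hS hne => Or.inl (h.2 hS hne)⟩
        · exact ⟨hA, fun S hS hne => Or.inr ⟨hne, hS.trans hAB⟩⟩
      singleton_mem := fun v => Or.inl (G.complex.singleton_mem v) }

/-- The mDAG obtained by merging `C` and `D` into `C ∪ D`. -/
def merge [DecidableEq V] (G : MDAG V) (C D : Finset V) : MDAG V := G.addFace (C ∪ D)

/-- The hypotheses of Weak Facet-Merging (and of Evans' rule) on `C` and `D`. -/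
structure WeakFM (G : MDAG V) (C D : Finset V) : Prop where
  facet_left : G.IsFacet C
  facet_right : G.IsFacet D
  disjoint : Disjoint C D
  parents : ∀ d ∈ D, G.dag.paSet (C : Set V) ∪ (C : Set V) ⊆ G.dag.pa d
  /-- For every `c ∈ C`, `C` is the only facet that contains `c`. -/
  only_facet : ∀ c ∈ C, ∀ B, G.IsFacet B → c ∈ B → B = C

/-- The hypotheses of Moderate Facet-Merging on `C` and `D`. Here `D` may be any face (a facet in
particular), and the last condition is asked of facets only: a facet `D` is not properly contained
in any face, so that for a facet `D` disjoint from `C` the last condition would leave nothing but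
Weak Facet-Merging. -/
structure ModerateFM (G : MDAG V) (C D : Finset V) : Prop where
  facet_left : G.IsFacet C
  face_right : D ∈ G.complex
  disjoint : Disjoint C D
  parents : ∀ d ∈ D, G.dag.paSet (C : Set V) ∪ (C : Set V) ⊆ G.dag.pa d
  /-- A facet that contains some `c ∈ C` and is not contained in `C` contains all of `D`. -/
  other_facets : ∀ B, G.IsFacet B → ¬ B ⊆ C → (∃ c ∈ C, c ∈ B) → D ⊆ B

/-- `ModerateFM` covers the case of two disjoint facets `C` and `D` such that every face that
contains some `c ∈ C` and is not contained in `C` contains `D`. -/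
theorem ModerateFM.of_faces {G : MDAG V} {C D : Finset V} (hC : G.IsFacet C) (hD : G.IsFacet D)
    (hCD : Disjoint C D)
    (hpa : ∀ d ∈ D, G.dag.paSet (C : Set V) ∪ (C : Set V) ⊆ G.dag.pa d)
    (h : ∀ B ∈ G.complex, ¬ B ⊆ C → (∃ c ∈ C, c ∈ B) → D ⊆ B) : G.ModerateFM C D :=
  ⟨hC, hD.prop, hCD, hpa, fun B hB => h B hB.prop⟩

end MDAG

end CausalStructure

end

open CausalStructure

noncomputable section

/-! ### Finite sums and sampling. -/

namespace CausalStructure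

universe u w

/-! The latent variable of the merged facet `C ∪ D` can be split into one acting on `C` and an
independent one acting on `D`. Keep the original variable for `C`. By the hypotheses, each node of
`D` sees `C`, the parents of `C`, and every other latent variable that acts on `C`, so it can
compute the posterior of the original variable given all of these. The new variable is a random seed
shared by `D`: from it the nodes of `D` all draw the same fresh value from that posterior. By Bayes'
rule, once the original value is summed out, the redrawn value has the same joint weight with `C` as
the original had, so the visible distribution is unchanged (`posterior_congr`,
`exists_dist_eq_of_split`). To make this usable, realizability is translated into models with
stochastic kernels (`exists_latentModel`, `dist_mem_realizable`), where a latent variable may sit on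
any set contained in a facet. The seed comes from `exists_sampler`. -/

theorem sum_pi_eq_of_sum_update_eq {I : Type*} [Fintype I] [DecidableEq I] {Λ : I → Type*}
    [∀ i, Fintype (Λ i)] (i₀ : I) {F F' : (∀ i, Λ i) → ℝ}
    (h : ∀ l, ∑ s, F (Function.update l i₀ s) = ∑ s, F' (Function.update l i₀ s)) :
    ∑ l, F l = ∑ l, F' l := by
  classical
  rw [← (Equiv.piSplitAt i₀ Λ).symm.sum_comp F, ← (Equiv.piSplitAt i₀ Λ).symm.sum_comp F',
    Fintype.sum_prod_type_right, Fintype.sum_prod_type_right]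
  refine Finset.sum_congr rfl fun r _ => ?_
  rcases isEmpty_or_nonempty (Λ i₀) with hΛ | ⟨⟨s₀⟩⟩
  · simp
  · have key : ∀ s, (Equiv.piSplitAt i₀ Λ).symm (s, r) =
        Function.update ((Equiv.piSplitAt i₀ Λ).symm (s₀, r)) i₀ s := by
      intro s
      funext j
      by_cases hj : j = i₀
      · subst hj
        simp [Equiv.piSplitAt]
      · simp [Equiv.piSplitAt, hj]
    rw [Fintype.sum_congr _ _ fun s => congrArg F (key s),
      Fintype.sum_congr _ _ fun s => congrArg F' (key s)]
    exact h _

/-- Finitely many distributions on a finite type can be simulated with one random variable, whose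
value is turned into a sample by a function that depends on the distribution only. -/
theorem exists_sampler {ι : Type*} {Λ : Type w} [Finite ι] [Fintype Λ] [Nonempty Λ]
    (q : ι → Λ → ℝ) (hq : ∀ i, q i ∈ stdSimplex ℝ Λ) :
    ∃ (U : Type w) (_ : Fintype U) (pU : U → ℝ) (g : (Λ → ℝ) → U → Λ),
      pU ∈ stdSimplex ℝ U ∧
      ∀ i (h : Λ → ℝ), ∑ t, pU t * h (g (q i) t) = ∑ l, q i l * h l := by
  classical
  have : Fintype (Set.range q) := Fintype.ofFinite _
  have hr : ∀ r : Set.range q, (r : Λ → ℝ) ∈ stdSimplex ℝ Λ := by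
    rintro ⟨_, i, rfl⟩
    exact hq i
  -- The random variable is a family of independent samples, one for each distribution in the range
  -- of `q`; `g d` reads the sample for `d`. Indexing by the range makes equal distributions share a
  -- sample; the default value is for distributions outside it.
  refine ⟨Set.range q → Λ, inferInstance, fun t => ∏ r : Set.range q, r.1 (t r),
    fun d t => if h : d ∈ Set.range q then t ⟨d, h⟩ else Classical.arbitrary Λ, ⟨?_, ?_⟩, ?_⟩
  · exact fun t => prod_nonneg fun r _ => (hr r).1 _
  · rw [← Fintype.prod_sum fun (r : Set.range q) l => r.1 l]
    exact prod_eq_one fun r _ => (hr r).2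
  · intro i h
    set r₀ : Set.range q := ⟨q i, i, rfl⟩
    have h1 : ∀ t : Set.range q → Λ, (∏ r : Set.range q, r.1 (t r)) *
        h (if h : q i ∈ Set.range q then t ⟨q i, h⟩ else Classical.arbitrary Λ) =
        ∏ r : Set.range q, (r.1 (t r) * if r = r₀ then h (t r) else 1) := by
      intro t
      rw [prod_mul_distrib, prod_ite_eq' univ r₀ fun r => h (t r)]
      simp [r₀]
    -- Every coordinate except that of `q i` integrates to 1.
    rw [sum_congr rfl fun t _ => h1 t,
      ← Fintype.prod_sum fun (r : Set.range q) l => r.1 l * if r = r₀ then h l else 1,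
      prod_eq_single r₀]
    · simp [r₀]
    · intro r _ hne
      simpa [hne] using (hr r).2
    · simp

/-! ### Models with stochastic kernels and independent latent variables. -/

/-- A causal model in which the visible variables are drawn from distributions (`kernel`), given
the visible parents and those of the independent latent variables whose set `S i` contains the
node. -/
structure LatentModel {V : Type u} (G : DAG V) {I : Type*} (S : I → Finset V) (cV : V → ℕ) where
  /-- the state spaces of the latent variables -/
  Λ : I → Type w
  [fintype : ∀ i, Fintype (Λ i)]
  /-- the distributions of the latent variables -/
  prior : ∀ i, Λ i → ℝ
  prior_mem : ∀ i, prior i ∈ stdSimplex ℝ (Λ i)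
  /-- the conditional distributions of the visible variables -/
  kernel : ∀ v, (∀ v, Fin (cV v)) → (∀ i, Λ i) → Fin (cV v) → ℝ
  kernel_mem : ∀ v x l, kernel v x l ∈ stdSimplex ℝ (Fin (cV v))
  kernel_congr : ∀ v x x' l l', (∀ u ∈ G.pa v, x u = x' u) → (∀ i, v ∈ S i → l i = l' i) →
    kernel v x l = kernel v x' l'

namespace LatentModel

attribute [instance] LatentModel.fintype

variable {V : Type u} {G : DAG V} {I : Type*} {S : I → Finset V} {cV : V → ℕ}

open Classical in
/-- The distribution of the visible variables. -/
def dist [Fintype V] [Fintype I] (M : LatentModel.{u, w} G S cV)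
    (x : ∀ v, Fin (cV v)) : ℝ :=
  ∑ l : ∀ i, M.Λ i, (∏ i, M.prior i (l i)) * ∏ v, M.kernel v x l (x v)

theorem dist_eq_of_equiv [Fintype V] [Fintype I] {I' : Type*} [Fintype I'] {S' : I' → Finset V}
    (M : LatentModel.{u, w} G S cV) (M' : LatentModel G S' cV)
    (E : (∀ i, M.Λ i) ≃ ∀ i, M'.Λ i) (hprior : ∀ l, ∏ i, M.prior i (l i) = ∏ i, M'.prior i (E l i))
    (hkernel : ∀ v x l, M.kernel v x l = M'.kernel v x (E l)) : M.dist = M'.dist := by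
  classical
  funext x
  refine Fintype.sum_equiv E _ _ fun l => ?_
  simp only [hprior, hkernel]

theorem nonempty_state (M : LatentModel.{u, w} G S cV) (i : I) : Nonempty (M.Λ i) := by
  by_contra h
  rw [not_nonempty_iff] at h
  simpa using (M.prior_mem i).2

end LatentModel

open Classical in
/-- The conditional distribution of a node given its parents. -/
def Parameters.kernel {N : Type*} {G : DAG N} {card : N → ℕ} (θ : Parameters G card) (a : N)
    (b : ∀ b : G.pa a, Fin (card b)) (i : Fin (card a)) : ℝ :=
  ∑ e, (if i = θ.f a b e then 1 else 0) * θ.errProb a e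

theorem Parameters.kernel_mem {N : Type*} {G : DAG N} {card : N → ℕ} (θ : Parameters G card)
    (a : N) (b : ∀ b : G.pa a, Fin (card b)) : θ.kernel a b ∈ stdSimplex ℝ (Fin (card a)) := by
  classical
  refine ⟨fun i => sum_nonneg fun e _ => mul_nonneg ?_ ((θ.errProb_mem a).1 e), ?_⟩
  · split_ifs <;> simp
  · simp only [Parameters.kernel]
    rw [sum_comm]
    simpa using (θ.errProb_mem a).2

open Classical in
-- Each error variable enters a single factor, so the sum over errors distributes over the product.
theorem Parameters.visible_eq {V L : Type*} [Fintype V] [Fintype L]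
    {G : PDAG V L} {cV : V → ℕ} {cL : L → ℕ} (θ : Parameters G (Sum.elim cV cL))
    (x : ∀ v, Fin (cV v)) :
    θ.visible x = ∑ y : ∀ l, Fin (cL l),
      ∏ a, θ.kernel a (fun b => combine x y b) (combine x y a) := by
  unfold Parameters.visible Parameters.kernel
  refine Finset.sum_congr rfl fun y _ => ?_
  rw [Fintype.prod_sum]

/-- Arbitrary conditional distributions of the nodes can be realized by functions of the parents
and an error variable. -/
theorem Parameters.exists_kernel_eq {N : Type*} [Finite N] {G : DAG N} {card : N → ℕ}
    (hc : ∀ a, Nonempty (Fin (card a)))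
    (κ : ∀ a, (∀ b : G.pa a, Fin (card b)) → Fin (card a) → ℝ)
    (hκ : ∀ a b, κ a b ∈ stdSimplex ℝ (Fin (card a))) :
    ∃ θ : Parameters G card, ∀ a b, θ.kernel a b = κ a b := by
  classical
  choose U hU p g hp hg using fun a => exists_sampler (κ a) (hκ a)
  refine ⟨⟨fun a => Fintype.card (U a), fun a e => p a ((Fintype.equivFin _).symm e), ?_,
    fun a b e => g a (κ a b) ((Fintype.equivFin _).symm e)⟩, fun a b => funext fun i => ?_⟩
  · refine fun a => ⟨fun e => (hp a).1 _, ?_⟩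
    rw [(Fintype.equivFin (U a)).symm.sum_comp (p a)]
    exact (hp a).2
  · unfold Parameters.kernel
    rw [(Fintype.equivFin (U a)).symm.sum_comp
      fun t => (if i = g a (κ a b) t then (1 : ℝ) else 0) * p a t]
    have := hg a b fun j => if i = j then 1 else 0
    simp only [mul_comm (p a _)] at this
    rw [this]
    simp

/-! ### Realizability by canonical pDAGs in terms of latent models. -/

namespace MDAG

variable {V : Type u} {G : MDAG V} {cV : V → ℕ}

theorem pa_can_inl_inl {u v : V} : Sum.inl u ∈ G.can.pa (Sum.inl v) ↔ u ∈ G.dag.pa v :=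
  ⟨fun h => by cases h with | directed h => exact h, fun h => .directed h⟩

theorem pa_can_inl_inr {A : G.Latent} {v : V} :
    Sum.inr A ∈ G.can.pa (Sum.inl v) ↔ v ∈ A.1 :=
  ⟨fun h => by cases h with | latent h => exact h, fun h => .latent h⟩

instance isEmpty_pa_can_inr (A : G.Latent) : IsEmpty (G.can.pa (Sum.inr A)) :=
  ⟨fun ⟨_, h⟩ => by cases h⟩

variable [Fintype V]

/-- A distribution that is realizable by the canonical pDAG is that of a model with one latent
variable for each facet. -/
theorem exists_latentModel {P : (∀ v, Fin (cV v)) → ℝ} (hP : P ∈ realizable G.can cV) :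
    ∃ M : LatentModel.{u, 0} G.dag (Subtype.val : G.Latent → Finset V) cV, P = M.dist := by
  obtain ⟨-, cL, θ, hθ⟩ := hP
  refine ⟨⟨fun A => Fin (cL A), fun A => θ.kernel (Sum.inr A) (fun b => isEmptyElim b),
    fun A => θ.kernel_mem (Sum.inr A) _, fun v x l => θ.kernel (Sum.inl v) (fun b => combine x l b),
    fun v x l => θ.kernel_mem (Sum.inl v) _, fun v x x' l l' hx hl => ?_⟩, funext fun x => ?_⟩
  · congr 1
    funext ⟨b, hb⟩
    rcases b with u | A
    · exact hx u (pa_can_inl_inl.1 hb)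
    · exact hl A (pa_can_inl_inr.1 hb)
  · rw [hθ, θ.visible_eq]
    refine Finset.sum_congr rfl fun y _ => ?_
    rw [Fintype.prod_sum_type, mul_comm]
    congr 1
    refine prod_congr rfl fun A _ => ?_
    exact congrArg (fun b => θ.kernel (Sum.inr A) b (y A)) (Subsingleton.elim _ _)

open Classical in
-- Converse of `exists_latentModel`: the kernels become functions of parents and errors by
-- `Parameters.exists_kernel_eq`.
theorem dist_mem_realizable (M : LatentModel.{u, w} G.dag (Subtype.val : G.Latent → Finset V) cV)
    (hM : M.dist ∈ stdSimplex ℝ (∀ v, Fin (cV v))) : M.dist ∈ realizable G.can cV := by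
  refine ⟨hM, fun A => Fintype.card (M.Λ A), ?_⟩
  obtain ⟨x₀⟩ : Nonempty (∀ v, Fin (cV v)) := by
    by_contra h
    rw [not_nonempty_iff] at h
    simpa using hM.2
  set e : ∀ A, M.Λ A ≃ Fin (Fintype.card (M.Λ A)) := fun A => Fintype.equivFin _
  let l₀ : ∀ A, M.Λ A := fun A => (M.nonempty_state A).some
  let card : V ⊕ G.Latent → ℕ := Sum.elim cV fun A => Fintype.card (M.Λ A)
  -- Only the values of the parents are available; the remaining arguments of the kernel are filled
  -- with `x₀` and `l₀`, which is harmless by `kernel_congr`.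
  let κ : ∀ a, (∀ b : G.can.pa a, Fin (card b)) → Fin (card a) → ℝ := fun a =>
    match a with
    | Sum.inl v => fun b => M.kernel v
        (fun u => if h : Sum.inl u ∈ G.can.pa (Sum.inl v) then b ⟨Sum.inl u, h⟩ else x₀ u)
        (fun A => if h : Sum.inr A ∈ G.can.pa (Sum.inl v) then (e A).symm (b ⟨Sum.inr A, h⟩)
          else l₀ A)
    | Sum.inr A => fun _ i => M.prior A ((e A).symm i)
  have hκ : ∀ a b, κ a b ∈ stdSimplex ℝ (Fin (card a)) := by
    rintro (v | A) b
    · exact M.kernel_mem _ _ _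
    · exact ⟨fun i => (M.prior_mem A).1 _,
        ((e A).symm.sum_comp (M.prior A)).trans (M.prior_mem A).2⟩
  have hc : ∀ a, Nonempty (Fin (card a)) := by
    rintro (v | A)
    · exact ⟨x₀ v⟩
    · exact ⟨e A (l₀ A)⟩
  obtain ⟨θ, hθ⟩ := Parameters.exists_kernel_eq hc κ hκ
  refine ⟨θ, fun x => ?_⟩
  rw [θ.visible_eq, LatentModel.dist]
  refine (@Fintype.sum_equiv _ _ _ (_) (_) _ (Equiv.piCongrRight e).symm _ _ fun y => ?_).symm
  symm
  rw [Fintype.prod_sum_type, mul_comm]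
  congr 1
  · refine prod_congr rfl fun v _ => ?_
    rw [hθ]
    refine congrFun (M.kernel_congr v _ _ _ _ (fun u hu => ?_) fun A hA => ?_) _
    · exact (dif_pos (t := fun _ => x u) (e := fun _ => x₀ u) (pa_can_inl_inl.2 hu)).symm
    · exact (dif_pos (t := fun _ => (e A).symm (y A)) (e := fun _ => l₀ A)
        (pa_can_inl_inr.2 hA)).symm
  · refine prod_congr rfl fun A _ => ?_
    rw [hθ]
    rfl

open Classical in
/-- A model each of whose latent variables acts on nodes of one facet only is realizable. -/
theorem dist_mem_realizable_of_subset {I : Type*} [Fintype I] {S : I → Finset V}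
    (φ : I → G.Latent) (hφ : ∀ i, S i ⊆ (φ i).1) (M : LatentModel.{u, w} G.dag S cV)
    (hM : M.dist ∈ stdSimplex ℝ (∀ v, Fin (cV v))) : M.dist ∈ realizable G.can cV := by
  -- All latent variables assigned by `φ` to the same facet are bundled into one product variable.
  let E : (∀ A : G.Latent, ∀ i : {i // φ i = A}, M.Λ i) ≃ ∀ i, M.Λ i :=
    { toFun := fun l i => l (φ i) ⟨i, rfl⟩
      invFun := fun l A i => l i
      left_inv := fun l => by
        funext A ⟨i, hi⟩
        subst hi
        rfl
      right_inv := fun l => rfl }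
  let M' : LatentModel G.dag (Subtype.val : G.Latent → Finset V) cV :=
    { Λ := fun A => ∀ i : {i // φ i = A}, M.Λ i
      prior := fun A l => ∏ i : {i // φ i = A}, M.prior i (l i)
      prior_mem := fun A => by
        refine ⟨fun l => prod_nonneg fun i _ => (M.prior_mem i).1 _, ?_⟩
        rw [← Fintype.prod_sum fun (i : {i // φ i = A}) t => M.prior i t]
        exact prod_eq_one fun i _ => (M.prior_mem i).2
      kernel := fun v x l => M.kernel v x (E l)
      kernel_mem := fun v x l => M.kernel_mem _ _ _
      kernel_congr := fun v x x' l l' hx hl =>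
        M.kernel_congr v _ _ _ _ hx fun i hi => congrFun (hl (φ i) (hφ i hi)) ⟨i, rfl⟩ }
  have h : M.dist = M'.dist := by
    refine (M'.dist_eq_of_equiv M E (fun l => ?_) fun v x l => rfl).symm
    rw [← Fintype.prod_fiberwise φ]
    refine prod_congr rfl fun A _ => prod_congr rfl fun i _ => ?_
    obtain ⟨i, rfl⟩ := i
    rfl
  rw [h] at hM ⊢
  exact dist_mem_realizable M' hM

theorem exists_facet_superset {B : Finset V} (hB : B ∈ G.complex) : ∃ A : G.Latent, B ⊆ A.1 := by
  obtain ⟨A, hBA, hA⟩ := (Set.toFinite {B | B ∈ G.complex}).exists_le_maximal hB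
  exact ⟨⟨A, hA⟩, hBA⟩

/-- Each facet of the smaller complex lies in a facet of the larger one, which can host its latent
variable; kernels may ignore additional parents. -/
theorem StructDominates.obsDominates {G' : MDAG V} (h : G.StructDominates G') :
    G.ObsDominates G' := by
  intro cV P hP
  obtain ⟨M, rfl⟩ := exists_latentModel hP
  choose φ hφ using fun A : G'.Latent => exists_facet_superset (h.2 A.2.prop)
  let M' : LatentModel G.dag (Subtype.val : G'.Latent → Finset V) cV :=
    { Λ := M.Λ
      prior := M.prior
      prior_mem := M.prior_mem
      kernel := M.kernel
      kernel_mem := M.kernel_mem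
      kernel_congr := fun v x x' l l' hx hl =>
        M.kernel_congr v x x' l l' (fun u hu => hx u (h.1 u v hu)) hl }
  have hM : M.dist = M'.dist := rfl
  rw [hM] at hP ⊢
  exact dist_mem_realizable_of_subset φ hφ M' hP.1

end MDAG

/-! ### Splitting a latent variable by redrawing it from its posterior. -/

namespace LatentModel

variable {V : Type u} {G : DAG V} {I : Type*} {S : I → Finset V} {cV : V → ℕ}

section Posterior

variable [DecidableEq I] (M : LatentModel.{u, w} G S cV) (i₀ : I) (C : Finset V)

/-- The joint weight of a value of the latent variable `i₀` and of the values of the nodes in `C`,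
given everything else. -/
def weight (x : ∀ v, Fin (cV v)) (l : ∀ i, M.Λ i) (t : M.Λ i₀) : ℝ :=
  M.prior i₀ t * ∏ c ∈ C, M.kernel c x (Function.update l i₀ t) (x c)

/-- The conditional distribution of the latent variable `i₀`, given the nodes in `C`, their parents
and the other latent variables that act on them. -/
def posterior (x : ∀ v, Fin (cV v)) (l : ∀ i, M.Λ i) (t : M.Λ i₀) : ℝ :=
  if ∑ s, M.weight i₀ C x l s = 0 then M.prior i₀ t
  else M.weight i₀ C x l t / ∑ s, M.weight i₀ C x l s

variable {M i₀ C}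

theorem weight_nonneg (x : ∀ v, Fin (cV v)) (l : ∀ i, M.Λ i) (t : M.Λ i₀) :
    0 ≤ M.weight i₀ C x l t :=
  mul_nonneg ((M.prior_mem i₀).1 t) (prod_nonneg fun c _ => (M.kernel_mem c x _).1 _)

theorem posterior_mem (x : ∀ v, Fin (cV v)) (l : ∀ i, M.Λ i) :
    M.posterior i₀ C x l ∈ stdSimplex ℝ (M.Λ i₀) := by
  by_cases h : ∑ s, M.weight i₀ C x l s = 0
  · have : M.posterior i₀ C x l = M.prior i₀ := funext fun t => if_pos h
    rw [this]
    exact M.prior_mem i₀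
  · have : M.posterior i₀ C x l = fun t => M.weight i₀ C x l t / ∑ s, M.weight i₀ C x l s :=
      funext fun t => if_neg h
    rw [this]
    refine ⟨fun t => div_nonneg (weight_nonneg x l t) (sum_nonneg fun s _ => weight_nonneg x l s),
      ?_⟩
    rw [← sum_div, div_self h]

/-- Bayes' rule. If the total weight is zero, all the nonnegative weights vanish, so the default
value of the posterior is immaterial. -/
theorem sum_weight_mul_posterior (x : ∀ v, Fin (cV v)) (l : ∀ i, M.Λ i) (t : M.Λ i₀) :
    (∑ s, M.weight i₀ C x l s) * M.posterior i₀ C x l t = M.weight i₀ C x l t := by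
  unfold posterior
  split_ifs with h
  · rw [h, zero_mul]
    exact ((sum_eq_zero_iff_of_nonneg fun s _ => weight_nonneg x l s).1 h t (mem_univ t)).symm
  · rw [mul_div_cancel₀ _ h]

theorem weight_update (x : ∀ v, Fin (cV v)) (l : ∀ i, M.Λ i) (s : M.Λ i₀) :
    M.weight i₀ C x (Function.update l i₀ s) = M.weight i₀ C x l := by
  funext t
  simp [weight]

/-- The posterior ignores the current value of `i₀`, so it is constant in the sum over that value.
-/
theorem posterior_update (x : ∀ v, Fin (cV v)) (l : ∀ i, M.Λ i) (s : M.Λ i₀) :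
    M.posterior i₀ C x (Function.update l i₀ s) = M.posterior i₀ C x l := by
  funext t
  simp only [posterior, weight_update]

/-- This is where both conditions of the merging rule enter: everything the posterior depends on is
visible to each `d ∈ D` without access to `i₀`. -/
theorem posterior_congr {D : Finset V}
    (hpa : ∀ d ∈ D, ∀ c ∈ C, c ∈ G.pa d ∧ G.pa c ⊆ G.pa d)
    (hS : ∀ i, i ≠ i₀ → ∀ c ∈ C, c ∈ S i → D ⊆ S i) {d : V} (hd : d ∈ D)
    {x x' : ∀ v, Fin (cV v)} {l l' : ∀ i, M.Λ i} (hx : ∀ u ∈ G.pa d, x u = x' u)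
    (hl : ∀ i, i ≠ i₀ → d ∈ S i → l i = l' i) :
    M.posterior i₀ C x l = M.posterior i₀ C x' l' := by
  have hw : M.weight i₀ C x l = M.weight i₀ C x' l' := by
    funext t
    unfold weight
    congr 1
    refine prod_congr rfl fun c hc => ?_
    rw [hx c (hpa d hd c hc).1]
    refine congrFun (M.kernel_congr c _ _ _ _ (fun u hu => hx u ((hpa d hd c hc).2 hu))
      fun i hi => ?_) _
    by_cases h : i = i₀
    · subst h
      simp
    · simpa [h] using hl i h (hS i h c hc hi hd)
  funext t
  simp only [posterior, hw]

end Posterior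

variable [Fintype V] [Fintype I]

open Classical in
/-- A latent variable that acts on `C ∪ D` may be replaced by one that acts on `C` and one that acts
on `D`, if the nodes in `D` have access to everything that acts on the nodes in `C`: the nodes in
`D` draw the value of the original latent variable anew from its posterior distribution. -/
theorem exists_dist_eq_of_split (M : LatentModel.{u, w} G S cV) (i₀ : I) {C D : Finset V}
    (hCD : Disjoint C D) (hi₀ : ∀ v ∈ S i₀, v ∈ C ∨ v ∈ D)
    (hpa : ∀ d ∈ D, ∀ c ∈ C, c ∈ G.pa d ∧ G.pa c ⊆ G.pa d)
    (hS : ∀ i, i ≠ i₀ → ∀ c ∈ C, c ∈ S i → D ⊆ S i) :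
    ∃ M' : LatentModel.{u, w} G (fun o : Option I => o.elim D (Function.update S i₀ C)) cV,
      M'.dist = M.dist := by
  have := M.nonempty_state i₀
  obtain ⟨U, hU, p, g, hp, hg⟩ := exists_sampler
    (fun xl : (∀ v, Fin (cV v)) × (∀ i, M.Λ i) => M.posterior i₀ C xl.1 xl.2)
    fun xl => posterior_mem xl.1 xl.2
  let Λ' : Option I → Type w := fun o => o.elim U M.Λ
  -- All nodes of `D` use the same seed and the same posterior, hence the same redrawn value, so
  -- their correlation through `i₀` survives.
  let κ : ∀ v, (∀ v, Fin (cV v)) → U → (∀ i, M.Λ i) → Fin (cV v) → ℝ := fun v x s l =>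
    if v ∈ D then M.kernel v x (Function.update l i₀ (g (M.posterior i₀ C x l) s))
    else M.kernel v x l
  have hκ : ∀ v x x' s s' l l', (∀ u ∈ G.pa v, x u = x' u) → (v ∈ D → s = s') →
      (∀ i, i ≠ i₀ → v ∈ S i → l i = l' i) → (v ∈ C → l i₀ = l' i₀) →
      κ v x s l = κ v x' s' l' := by
    intro v x x' s s' l l' hx hs hl hl₀
    dsimp only [κ]
    split_ifs with hv
    · rw [hs hv, posterior_congr hpa hS hv hx hl]
      refine M.kernel_congr v _ _ _ _ hx fun i hi => ?_
      by_cases h : i = i₀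
      · subst h
        simp
      · simpa [h] using hl i h hi
    · refine M.kernel_congr v _ _ _ _ hx fun i hi => ?_
      by_cases h : i = i₀
      · subst h
        exact hl₀ (by simpa [hv] using hi₀ v hi)
      · exact hl i h hi
  let M' : LatentModel.{u, w} G
      (fun o : Option I => o.elim D (Function.update S i₀ C)) cV :=
    { Λ := Λ'
      fintype := fun o => match o with
        | none => hU
        | some i => M.fintype i
      prior := fun o => match o with
        | none => p
        | some i => M.prior i
      prior_mem := fun o => match o with
        | none => hp
        | some i => M.prior_mem i
      kernel := fun v x l => κ v x (l none) (fun i => l (some i))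
      kernel_mem := fun v x l => by
        dsimp only [κ]
        split_ifs <;> exact M.kernel_mem _ _ _
      kernel_congr := fun v x x' l l' hx hl =>
        hκ v x x' _ _ _ _ hx (hl none) (fun i hi hv => hl (some i) (by simpa [hi])) fun h =>
          hl (some i₀) (by simpa) }
  refine ⟨M', funext fun x => ?_⟩
  have h1 : M'.dist x = ∑ sl : U × (∀ i, M.Λ i),
      (p sl.1 * ∏ i, M.prior i (sl.2 i)) * ∏ v, κ v x sl.1 sl.2 (x v) := by
    refine @Fintype.sum_equiv _ _ _ (_) (_) _ (Equiv.piOptionEquivProd (β := Λ')) _ _ fun l => ?_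
    rw [Fintype.prod_option]
    rfl
  let T : (∀ i, M.Λ i) → M.Λ i₀ → ℝ := fun l t =>
    ∏ d ∈ D, M.kernel d x (Function.update l i₀ t) (x d)
  -- Summing out the seed turns the redrawn value into an average over the posterior.
  have h2 : ∀ l, ∑ s, (p s * ∏ i, M.prior i (l i)) * ∏ v, κ v x s l (x v) =
      (∏ i, M.prior i (l i)) * (∏ v ∈ univ \ D, M.kernel v x l (x v)) *
        ∑ t, M.posterior i₀ C x l t * T l t := by
    intro l
    rw [← hg (x, l) (T l), mul_sum]
    refine Finset.sum_congr rfl fun s _ => ?_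
    rw [← prod_sdiff (subset_univ D)]
    have h3 : ∏ v ∈ univ \ D, κ v x s l (x v) = ∏ v ∈ univ \ D, M.kernel v x l (x v) :=
      prod_congr rfl fun v hv => by
        dsimp only [κ]
        rw [if_neg (mem_sdiff.1 hv).2]
    have h4 : ∏ v ∈ D, κ v x s l (x v) = T l (g (M.posterior i₀ C x l) s) :=
      prod_congr rfl fun v hv => by
        dsimp only [κ]
        rw [if_pos hv]
    rw [h3, h4]
    ring
  rw [h1, Fintype.sum_prod_type_right, Fintype.sum_congr _ _ h2, dist]
  -- It suffices to compare the sums over the value of `i₀`, with the other latent values fixed.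
  refine sum_pi_eq_of_sum_update_eq i₀ fun l => ?_
  let A : ℝ := ∏ i ∈ univ.erase i₀, M.prior i (l i)
  let B : ℝ := ∏ v ∈ (univ \ D) \ C, M.kernel v x l (x v)
  have hA : ∀ s, ∏ i, M.prior i (Function.update l i₀ s i) = M.prior i₀ s * A := by
    intro s
    rw [← mul_prod_erase univ _ (mem_univ i₀), Function.update_self]
    congr 1
    refine prod_congr rfl fun i hi => ?_
    rw [Function.update_of_ne (ne_of_mem_erase hi)]
  have hB : ∀ s, ∏ v ∈ univ \ D, M.kernel v x (Function.update l i₀ s) (x v) =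
      B * ∏ c ∈ C, M.kernel c x (Function.update l i₀ s) (x c) := by
    intro s
    have hC : C ⊆ univ \ D := fun c hc =>
      mem_sdiff.2 ⟨mem_univ c, Finset.disjoint_left.1 hCD hc⟩
    rw [← prod_sdiff hC]
    congr 1
    refine prod_congr rfl fun v hv => ?_
    refine congrFun (M.kernel_congr v _ _ _ _ (fun _ _ => rfl) fun i hi => ?_) _
    by_cases h : i = i₀
    · subst h
      have := hi₀ v hi
      simp only [mem_sdiff] at hv
      tauto
    · rw [Function.update_of_ne h]
  have hT : ∀ s, T (Function.update l i₀ s) = T l := by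
    intro s
    funext t
    simp [T]
  simp only [← prod_sdiff (subset_univ D), hA, hB, hT, posterior_update]
  -- The original value `s` now affects only `C` and sums to the total weight; multiplied by the
  -- posterior, this gives back the weight of the redrawn value `t`, which plays the role of the
  -- original one.
  calc ∑ s, M.prior i₀ s * A * (B * ∏ c ∈ C, M.kernel c x (Function.update l i₀ s) (x c)) *
        ∑ t, M.posterior i₀ C x l t * T l t
      = A * B * ((∑ s, M.weight i₀ C x l s) * ∑ t, M.posterior i₀ C x l t * T l t) := by
        rw [sum_mul, mul_sum]
        refine Finset.sum_congr rfl fun s _ => ?_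
        rw [weight]
        ring
    _ = A * B * ∑ t, M.weight i₀ C x l t * T l t := by
        congr 1
        rw [mul_sum]
        refine Finset.sum_congr rfl fun t _ => ?_
        rw [← mul_assoc, sum_weight_mul_posterior]
    _ = _ := by
        rw [mul_sum]
        refine Finset.sum_congr rfl fun s _ => ?_
        rw [weight]
        ring

end LatentModel

/-! ### The merging rule. -/

namespace MDAG

variable {V : Type u}

theorem le_addFace (G : MDAG V) (B : Finset V) : (G.addFace B).StructDominates G :=
  ⟨fun _ _ h => h, fun _ h => Or.inl h⟩

/-- Every facet that meets `C` is `C` itself, so the condition on other facets is vacuous. -/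
theorem WeakFM.moderateFM {G : MDAG V} {C D : Finset V} (h : G.WeakFM C D) : G.ModerateFM C D :=
  ⟨h.facet_left, h.facet_right.prop, h.disjoint, h.parents, fun B hB hBC ⟨c, hc, hcB⟩ =>
    absurd (h.only_facet c hc B hB hcB).le hBC⟩

variable [DecidableEq V] {G : MDAG V} {C D : Finset V}

/-- Since `D` is nonempty and disjoint from `C`, an old face containing `C ∪ D` would strictly
contain the facet `C`. -/
theorem ModerateFM.isFacet_union (h : G.ModerateFM C D) : (G.merge C D).IsFacet (C ∪ D) := by
  have hD : D.Nonempty := (G.complex.isRelLowerSet_faces h.face_right).1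
  refine ⟨Or.inr ⟨hD.mono subset_union_right, Subset.rfl⟩, fun A hA hle => ?_⟩
  rcases hA with hA | hA
  · obtain ⟨d, hd⟩ := hD
    have hAC : A ⊆ C := h.facet_left.2 hA (subset_union_left.trans hle)
    exact absurd hd (Finset.disjoint_left.1 h.disjoint (hAC (hle (mem_union_right C hd))))
  · exact hA.2

theorem ModerateFM.isFacet_of_ne (h : G.ModerateFM C D) {A : Finset V}
    (hA : (G.merge C D).IsFacet A) (hne : A ≠ C ∪ D) : G.IsFacet A := by
  rcases hA.prop with hA' | hA'
  · exact ⟨hA', fun B hB hle => hA.2 (Or.inl hB) hle⟩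
  · exact absurd (hA'.2.antisymm (hA.2 h.isFacet_union.prop hA'.2)) hne

theorem ModerateFM.obsDominates [Fintype V] (h : G.ModerateFM C D) :
    G.ObsDominates (G.merge C D) := by
  intro cV P hP
  obtain ⟨M, rfl⟩ := exists_latentModel hP
  have hpa : ∀ d ∈ D, ∀ c ∈ C, c ∈ G.dag.pa d ∧ G.dag.pa c ⊆ G.dag.pa d := fun d hd c hc =>
    ⟨h.parents d hd (Or.inr hc), fun u hu => h.parents d hd
      (Or.inl (Set.mem_biUnion (show c ∈ (C : Set V) from hc) hu))⟩
  have hS : ∀ A : (G.merge C D).Latent, A ≠ ⟨C ∪ D, h.isFacet_union⟩ → ∀ c ∈ C, c ∈ A.1 →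
      D ⊆ A.1 := fun A hA c hc hcA => by
    have hne : A.1 ≠ C ∪ D := fun h' => hA (Subtype.ext h')
    -- A facet of the merged complex inside `C` would lie in the facet `C ∪ D` and so equal it.
    refine h.other_facets A.1 (h.isFacet_of_ne A.2 hne) (fun hAC => hne ?_) ⟨c, hc, hcA⟩
    have hle : A.1 ⊆ C ∪ D := hAC.trans subset_union_left
    exact hle.antisymm (A.2.2 h.isFacet_union.prop hle)
  obtain ⟨M', hM'⟩ := M.exists_dist_eq_of_split ⟨C ∪ D, h.isFacet_union⟩ h.disjoint
    (fun _ => mem_union.1) hpa hS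
  -- After the split, every latent variable acts on a face of `G`: on `D`, on `C`, or on an old
  -- facet.
  choose φ hφ using fun o : Option (G.merge C D).Latent =>
    exists_facet_superset (G := G) (B := o.elim D
      (Function.update Subtype.val ⟨C ∪ D, h.isFacet_union⟩ C)) (by
        rcases o with - | A
        · exact h.face_right
        · by_cases hA : A = ⟨C ∪ D, h.isFacet_union⟩
          · subst hA
            simpa using h.facet_left.prop
          · simpa [hA] using (h.isFacet_of_ne A.2 fun h' => hA (Subtype.ext h')).prop)
  rw [← hM'] at hP ⊢
  refine dist_mem_realizable_of_subset (G := G) φ (fun o => ?_) M' hP.1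
  convert hφ o

/-! ### Strictness of the relaxation. -/

/-- Two visible nodes `0` and `1`, both parents of `2`, with the facets `{0, 1}` and `{0, 2}`. -/
def colliderExample : MDAG (Fin 3) where
  dag :=
    { edge := fun a b => a ≠ 2 ∧ b = 2
      acyclic := fun a h => by
        have : ∀ b, Relation.TransGen (fun a b : Fin 3 => a ≠ 2 ∧ b = 2) a b → a ≠ 2 ∧ b = 2 := by
          intro b hb
          induction hb with
          | single h => exact h
          | tail _ h ih => exact ⟨ih.1, h.2⟩
        exact (this a h).1 (this a h).2 }
  complex :=
    { faces := {A | A.Nonempty ∧ (A ⊆ {0, 1} ∨ A ⊆ {0, 2})}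
      isRelLowerSet_faces := by
        rintro A ⟨hA, hA'⟩
        exact ⟨hA, fun B hB hne => ⟨hne, hA'.imp hB.trans hB.trans⟩⟩
      singleton_mem := by
        intro v
        refine ⟨singleton_nonempty v, ?_⟩
        revert v
        decide }

theorem mem_colliderExample {A : Finset (Fin 3)} :
    A ∈ colliderExample.complex ↔ A.Nonempty ∧ (A ⊆ {0, 1} ∨ A ⊆ {0, 2}) := Iff.rfl

theorem isFacet_colliderExample {A : Finset (Fin 3)} :
    colliderExample.IsFacet A ↔ A = {0, 1} ∨ A = {0, 2} := by
  have h : colliderExample.IsFacet A ↔ (A.Nonempty ∧ (A ⊆ {0, 1} ∨ A ⊆ {0, 2})) ∧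
      ∀ B : Finset (Fin 3), (B.Nonempty ∧ (B ⊆ {0, 1} ∨ B ⊆ {0, 2})) → A ⊆ B → B ⊆ A := by
    simp only [IsFacet, Maximal, mem_colliderExample]
  rw [h]
  clear h
  revert A
  decide

/-- The other facet `{0, 2}` meets `{0, 1}` but contains `{2}`, which is a face and not a facet. -/
theorem moderateFM_colliderExample : colliderExample.ModerateFM {0, 1} {2} where
  facet_left := isFacet_colliderExample.2 (Or.inl rfl)
  face_right := mem_colliderExample.2 (by decide)
  disjoint := by decide
  parents := by
    intro d hd u hu
    obtain rfl := mem_singleton.1 hd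
    rcases hu with hu | hu
    · obtain ⟨v, hv, huv⟩ := Set.mem_iUnion₂.1 hu
      exact ⟨huv.1, rfl⟩
    · refine ⟨?_, rfl⟩
      rintro rfl
      simp at hu
  other_facets := by
    intro B hB hBC _
    rcases isFacet_colliderExample.1 hB with rfl | rfl
    · exact absurd Subset.rfl hBC
    · decide

/-- Both facets contain `0`, so no two facets are disjoint. -/
theorem not_weakFM_colliderExample (C D : Finset (Fin 3)) : ¬ colliderExample.WeakFM C D := by
  intro h
  have hCD := h.disjoint
  rcases isFacet_colliderExample.1 h.facet_left with rfl | rfl <;>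
    rcases isFacet_colliderExample.1 h.facet_right with rfl | rfl <;> revert hCD <;> decide

end MDAG
end CausalStructure
end

theorem mainTheorem3 {V : Type*} [Fintype V] [DecidableEq V] (G : MDAG V) (C D : Finset V) :
    -- the rule: merging `C` and `D` gives an observationally equivalent mDAG
    (G.ModerateFM C D →
      G.ObsDominates (G.merge C D) ∧
      (G.merge C D).StructDominates G ∧
      (G.merge C D).ObsDominates G ∧
      G.ObsEquiv (G.merge C D)) ∧
    -- its hypotheses relax those of Weak Facet-Merging
    (G.WeakFM C D → G.ModerateFM C D) ∧
    -- and strictly so: it gives an equivalence that Weak Facet-Merging does not give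
    (∃ (G₀ : MDAG (Fin 3)) (C₀ D₀ : Finset (Fin 3)), G₀.ModerateFM C₀ D₀ ∧
      G₀.merge C₀ D₀ ≠ G₀ ∧
      ¬ ∃ C₁ D₁ : Finset (Fin 3), G₀.WeakFM C₁ D₁ ∧ G₀.merge C₁ D₁ = G₀.merge C₀ D₀) := by
  refine ⟨fun h => ?_, MDAG.WeakFM.moderateFM,
    MDAG.colliderExample, {0, 1}, {2}, MDAG.moderateFM_colliderExample, fun h => ?_,
    fun ⟨C₁, D₁, h, _⟩ => MDAG.not_weakFM_colliderExample C₁ D₁ h⟩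
  · have hs : (G.merge C D).StructDominates G := G.le_addFace (C ∪ D)
    exact ⟨h.obsDominates, hs, hs.obsDominates,
      fun cV => (h.obsDominates cV).antisymm (hs.obsDominates cV)⟩
  -- If merging changed nothing, all three nodes would already form a face.
  · have h1 := MDAG.moderateFM_colliderExample.isFacet_union.prop
    rw [h, MDAG.mem_colliderExample] at h1
    revert h1
    decide
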